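/- For nonnegative integers $n$ let $H_n=\sum_{k=1}^n \frac1k$ and $H_n^{(2)}=\sum_{k=1}^n\frac1{k^2}$, and let the Bernoulli numbers $B_n$ be given by $\sum_{n\ge 0}B_n\frac{t^n}{n!}=\frac{t}{e^t-1}$. For a prime $p$ and rational numbers $x,y$, write $x\equiv y\pmod{p^3}$ if $x$ and $y$ are $p$-integral (their reduced denominators are not divisible by $p$) and $x-y=p^3z$ for some $p$-integral rational number $z$. Theorem (a conjecture of Z.-W. Sun). For every prime $p>3$, $$\sum_{k=1}^{p-1}\frac{H_k^{(2)}}{k16^k}\binom{2k}{k}^2\equiv-12\frac{H_{p-1}}{p^2}+\frac{7}{10}p^2B_{p-5}\pmod{p^3}$$ and $$\sum_{k=\frac{p+1}{2}}^{p-1}\frac{H_k^{(2)}}{k16^k}\binom{2k}{k}^2\equiv\frac{31}{2}p^2B_{p-5}\pmod{p^3}.$$ -/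

import Mathlib

/-- The harmonic number of order `r`: `H_n^{(r)} = ∑_{k=1}^n 1 / k^r`, a rational number. -/
def harmonicOrder (r n : ℕ) : ℚ :=
  ∑ k ∈ Finset.Icc 1 n, 1 / (k : ℚ) ^ r

/-- For `r = 1` this is the usual harmonic number. -/
theorem harmonicOrder_one (n : ℕ) : harmonicOrder 1 n = harmonic n := by
  simp [harmonicOrder, harmonic_eq_sum_Icc]

/-- The congruence `x ≡ y (mod p ^ m)` between rational numbers, for a prime `p`: both `x` and `y`
are `p`-integral (their reduced denominators are prime to `p`), and `p ^ m` divides the numerator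
of the difference `x - y`, that is, `x - y` lies in `p ^ m` times the ring of `p`-integral
rationals. -/
def RatCongr (p m : ℕ) (x y : ℚ) : Prop :=
  ¬ p ∣ x.den ∧ ¬ p ∣ y.den ∧ ((p : ℤ) ^ m) ∣ (x - y).num

/-! Write F_N(l) for `shiftSum`. As i(i-1) + 1/4 = (i-1/2)^2, the sums in question are values
F_N(-1/4): N = p-1 gives the first, and subtracting N = n = (p-1)/2 gives the second. Two facts
determine F_N(-1/4) modulo p^3.

(1) The difference F_N(x(x+1)) - F_N((x-1)x) has a closed form (`shiftSum_sub`). At integers 1 ≤ x ≤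
N it equals -2/x^3, so F_N(m(m+1)) = -2 H_m^{(3)} for m ≤ N. (2) n(n+1) = -1/4 + p^2/4, so Taylor
expansion at n(n+1) gives F_N(-1/4) ≡ -2 H_n^{(3)} - (p^2/4) F_N'(n(n+1)), with the derivative
needed only modulo p (`dvd_shiftSum_add`).

For the derivative put G(x) = F_N(x(x+1)). Since 2n+1 = p, G''(n) ≡ 2 F_N'(n(n+1)). Modulo p the
product of 1 - x^2/j^2 over j ≤ n is 1 - x^(p-1), so G(x) - G(x-1) is an explicit polynomial whose
second derivative at j is a constant times 1/j^5. Summing over j ≤ n expresses G''(n) through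
H_n^{(5)} and G''(0) = -2 ∑ H_k^{(2)}/k^3, both multiples of B_{p-5}. The result is F_N' ≡ 62
B_{p-5} for N = p-1 and 124 B_{p-5} for N = n. Finally, H_n^{(3)} is traded for H_{p-1}/p^2 by
comparing the pairings {j, p-j} and {2j, p-2j} of 1, …, p-1. -/

open Finset

/-! ### A telescoping identity in a commutative ring with inverses of `1, …, N` -/

section Generic

variable {R : Type*} [CommRing R]

/-- `∑_{j=1}^n ι(j)^r`, where `ι(j)` plays the role of `1 / j`. -/
def invPowSum (ι : ℕ → R) (r n : ℕ) : R := ∑ i ∈ range n, ι (i + 1) ^ r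

/-- `∏_{i=1}^k (i (i - 1) - l) / i ^ 2`. -/
def shiftProd (ι : ℕ → R) (l : R) (k : ℕ) : R :=
  ∏ i ∈ range k, ((i : R) * (i + 1) - l) * ι (i + 1) ^ 2

/-- `∏_{i=1}^k (1 - x ^ 2 / i ^ 2)`. -/
def sineProd (ι : ℕ → R) (x : R) (k : ℕ) : R :=
  ∏ i ∈ range k, (1 - x ^ 2 * ι (i + 1) ^ 2)

/-- `∑_{k=1}^N H_k^{(2)} / k * ∏_{i=1}^k (i (i - 1) - l) / i ^ 2`. -/
def shiftSum (ι : ℕ → R) (l : R) (N : ℕ) : R :=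
  ∑ k ∈ range N, invPowSum ι 2 (k + 1) * ι (k + 1) * shiftProd ι l (k + 1)

variable {ι : ℕ → R} {N : ℕ}

/-- Since i(i-1) - x(x+1) = (i+x)(i-1-x), shifting the index of the second factor pairs i+x with i-x
and leaves only the end factors -x and k+1+x. -/
theorem shiftProd_succ_eq_sineProd (hι : ∀ j, 1 ≤ j → j ≤ N → (j : R) * ι j = 1) (x : R) (k : ℕ)
    (hk : k < N) :
    shiftProd ι (x * (x + 1)) (k + 1) = -x * (k + 1 + x) * ι (k + 1) ^ 2 * sineProd ι x k := by
  induction k with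
  | zero =>
    simp [shiftProd, sineProd]
    ring
  | succ k ih =>
    have h := ih (by omega)
    have h1 := hι (k + 1) (by omega) (by omega)
    rw [shiftProd, prod_range_succ, ← shiftProd, h, sineProd, sineProd, prod_range_succ]
    push_cast at h1 ⊢
    linear_combination (-x * (k + 1 + 1 + x) * ι (k + 1 + 1) ^ 2 *
      ∏ i ∈ range k, (1 - x ^ 2 * ι (i + 1) ^ 2)) * ((k + 1) * ι (k + 1) + 1) * h1

/-- (x-1)x arises from x(x+1) by x ↦ -x, and `sineProd` is even in x. -/
theorem shiftProd_sub (hι : ∀ j, 1 ≤ j → j ≤ N → (j : R) * ι j = 1) (x : R) (k : ℕ)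
    (hk : k < N) :
    shiftProd ι (x * (x + 1)) (k + 1) - shiftProd ι ((x - 1) * x) (k + 1) =
      -2 * x * (k + 1) * ι (k + 1) ^ 2 * sineProd ι x k := by
  have e : (x - 1) * x = (-x) * (-x + 1) := by ring
  have e2 : sineProd ι (-x) k = sineProd ι x k := by simp [sineProd]
  rw [e, shiftProd_succ_eq_sineProd hι x k hk, shiftProd_succ_eq_sineProd hι (-x) k hk, e2]
  ring

theorem shiftSum_sub (hι : ∀ j, 1 ≤ j → j ≤ N → (j : R) * ι j = 1) (x : R) :
    x ^ 3 * (shiftSum ι (x * (x + 1)) N - shiftSum ι ((x - 1) * x) N) =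
      2 * x ^ 2 * sineProd ι x N * invPowSum ι 2 N + 2 * (sineProd ι x N - 1) := by
  suffices h : ∀ M ≤ N, x ^ 3 * (shiftSum ι (x * (x + 1)) M - shiftSum ι ((x - 1) * x) M) =
      2 * x ^ 2 * sineProd ι x M * invPowSum ι 2 M + 2 * (sineProd ι x M - 1) from h N le_rfl
  intro M
  induction M with
  | zero => simp [shiftSum, sineProd, invPowSum]
  | succ k ih =>
    intro hk
    have h := ih (by omega)
    have h1 := hι (k + 1) (by omega) hk
    have h2 := shiftProd_sub hι x k (by omega)
    have e1 : invPowSum ι 2 (k + 1) = invPowSum ι 2 k + ι (k + 1) ^ 2 := sum_range_succ _ _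
    have e2 : sineProd ι x (k + 1) = sineProd ι x k * (1 - x ^ 2 * ι (k + 1) ^ 2) :=
      prod_range_succ _ _
    have e3 : ∀ l, shiftSum ι l (k + 1) =
        shiftSum ι l k + invPowSum ι 2 (k + 1) * ι (k + 1) * shiftProd ι l (k + 1) :=
      fun l => sum_range_succ _ _
    rw [e3, e3, e1, e2]
    push_cast at h1
    linear_combination h + x ^ 3 * (invPowSum ι 2 k + ι (k + 1) ^ 2) * ι (k + 1) * h2
      - 2 * x ^ 4 * (invPowSum ι 2 k + ι (k + 1) ^ 2) * ι (k + 1) ^ 2 * sineProd ι x k * h1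

theorem shiftSum_natCast (hι : ∀ j, 1 ≤ j → j ≤ N → (j : R) * ι j = 1) (m : ℕ) (hm : m ≤ N) :
    shiftSum ι ((m : R) * (m + 1)) N = -2 * invPowSum ι 3 m := by
  induction m with
  | zero =>
    simp only [shiftSum, shiftProd, prod_range_succ', invPowSum]
    simp
  | succ m ih =>
    have h := shiftSum_sub hι ((m + 1 : ℕ) : R)
    have h1 := hι (m + 1) (by omega) hm
    -- The factor with i = m+1 ≤ N vanishes, so only the -2 of `shiftSum_sub` survives.
    have hP : sineProd ι ((m + 1 : ℕ) : R) N = 0 := by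
      apply prod_eq_zero (mem_range.2 hm)
      linear_combination (-((m + 1 : ℕ) : R) * ι (m + 1) - 1) * h1
    have e : (((m + 1 : ℕ) : R) - 1) * ((m + 1 : ℕ) : R) = m * (m + 1) := by push_cast; ring
    rw [hP, e, ih (by omega)] at h
    have e2 : invPowSum ι 3 (m + 1) = invPowSum ι 3 m + ι (m + 1) ^ 3 := sum_range_succ _ _
    have h3 : (((m + 1 : ℕ) : R)) ^ 3 * ι (m + 1) ^ 3 = 1 := by rw [← mul_pow, h1, one_pow]
    rw [e2]
    linear_combination ι (m + 1) ^ 3 * h -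
      (shiftSum ι (((m + 1 : ℕ) : R) * (((m + 1 : ℕ) : R) + 1)) N + 2 * invPowSum ι 3 m) * h3

variable {T : Type*} [CommRing T]

theorem map_invPowSum (f : R →+* T) (ι : ℕ → R) (r n : ℕ) :
    f (invPowSum ι r n) = invPowSum (fun j => f (ι j)) r n := by
  simp [invPowSum]

theorem map_shiftSum (f : R →+* T) (ι : ℕ → R) (l : R) (N : ℕ) :
    f (shiftSum ι l N) = shiftSum (fun j => f (ι j)) (f l) N := by
  simp [shiftSum, shiftProd, map_invPowSum]

theorem map_sineProd (f : R →+* T) (ι : ℕ → R) (x : R) (N : ℕ) :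
    f (sineProd ι x N) = sineProd (fun j => f (ι j)) (f x) N := by
  simp [sineProd]

end Generic

/-! ### Splitting `1, …, 2n` into pairs -/

theorem sum_range_two_mul_eq_reflect {M : Type*} [AddCommMonoid M] (g : ℕ → M) (n : ℕ) :
    ∑ k ∈ range (2 * n), g (k + 1) = ∑ j ∈ range n, (g (j + 1) + g (2 * n + 1 - (j + 1))) := by
  rw [sum_add_distrib, two_mul, sum_range_add]
  congr 1
  rw [← sum_range_reflect]
  refine sum_congr rfl fun j hj => ?_
  have := mem_range.1 hj
  congr 1
  omega

theorem sum_range_two_mul_eq_double {M : Type*} [AddCommMonoid M] (g : ℕ → M) (n : ℕ) :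
    ∑ k ∈ range (2 * n), g (k + 1) =
      ∑ j ∈ range n, (g (2 * (j + 1)) + g (2 * n + 1 - 2 * (j + 1))) := by
  have h : ∑ k ∈ range (2 * n), g (k + 1) = ∑ j ∈ range n, (g (2 * j + 1) + g (2 * j + 2)) := by
    induction n with
    | zero => simp
    | succ n ih =>
      rw [sum_range_succ, ← ih, show 2 * (n + 1) = 2 * n + 1 + 1 by ring, sum_range_succ,
        sum_range_succ, add_assoc]
  rw [h, sum_add_distrib, sum_add_distrib, add_comm]
  congr 1
  rw [← sum_range_reflect]
  refine sum_congr rfl fun j hj => ?_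
  have := mem_range.1 hj
  congr 1
  omega

theorem prod_range_two_mul_eq_reflect {M : Type*} [CommMonoid M] (g : ℕ → M) (n : ℕ) :
    ∏ k ∈ range (2 * n), g (k + 1) = ∏ j ∈ range n, (g (j + 1) * g (2 * n + 1 - (j + 1))) :=
  sum_range_two_mul_eq_reflect (M := Additive M) g n

/-! ### The ring of `p`-integral rationals -/

/-- The subring of `ℚ` of rationals with denominator prime to `p`. -/
def pIntegers (p : ℕ) [hp : Fact p.Prime] : Subring ℚ where
  carrier := {x | ¬ p ∣ x.den}
  mul_mem' {a b} ha hb h :=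
    (hp.out.dvd_mul.1 (h.trans (Rat.mul_den_dvd a b))).elim ha hb
  one_mem' := by simpa using hp.out.one_lt.ne'
  add_mem' {a b} ha hb h :=
    (hp.out.dvd_mul.1 (h.trans (Rat.add_den_dvd a b))).elim ha hb
  zero_mem' := by simpa using hp.out.one_lt.ne'
  neg_mem' {a} ha := by simpa using ha

theorem not_prime_dvd_of_lt {p j : ℕ} (h1 : 1 ≤ j) (h2 : j < p) : ¬ p ∣ j :=
  fun h => absurd (Nat.le_of_dvd h1 h) (by omega)

section

variable {p : ℕ} [hp : Fact p.Prime]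

theorem mem_pIntegers {x : ℚ} : x ∈ pIntegers p ↔ ¬ p ∣ x.den := Iff.rfl

theorem den_cast_ne_zero (x : pIntegers p) : (((x : ℚ).den : ℕ) : ZMod p) ≠ 0 := by
  rw [Ne, ZMod.natCast_eq_zero_iff]
  exact x.2

theorem prime_cast_ne_zero : (p : pIntegers p) ≠ 0 := by
  intro h
  have := congrArg Subtype.val h
  push_cast at this
  exact hp.out.ne_zero (by exact_mod_cast this)

/-- Reduction modulo `p` of `p`-integral rationals. -/
def pReduce (p : ℕ) [Fact p.Prime] : pIntegers p →+* ZMod p where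
  toFun x := ((x : ℚ) : ZMod p)
  map_one' := by simp
  map_zero' := by simp
  map_add' x y := by
    simpa using Rat.cast_add_of_ne_zero (den_cast_ne_zero x) (den_cast_ne_zero y)
  map_mul' x y := by
    simpa using Rat.cast_mul_of_ne_zero (den_cast_ne_zero x) (den_cast_ne_zero y)

theorem inv_natCast_mem_pIntegers {j : ℕ} (hj : ¬ p ∣ j) : (j : ℚ)⁻¹ ∈ pIntegers p := by
  rw [mem_pIntegers]
  rcases Nat.eq_zero_or_pos j with rfl | h
  · simp at hj
  · rwa [Rat.inv_natCast_den_of_pos h]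

theorem dvd_of_pReduce_eq_zero {x : pIntegers p} (h : pReduce p x = 0) :
    (p : pIntegers p) ∣ x := by
  have h0 : (((x : ℚ).num : ℤ) : ZMod p) / ((x : ℚ).den : ZMod p) = 0 := by
    rw [← Rat.cast_def]; exact h
  rw [div_eq_zero_iff, or_iff_left (den_cast_ne_zero x), ZMod.intCast_zmod_eq_zero_iff_dvd] at h0
  obtain ⟨a, ha⟩ := h0
  refine ⟨(a : pIntegers p) * ⟨_, inv_natCast_mem_pIntegers x.2⟩, ?_⟩
  ext
  push_cast
  rw [← mul_assoc, ← div_eq_mul_inv]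
  conv_lhs => rw [← Rat.num_div_den (x : ℚ), ha]
  push_cast
  rfl

/-- The inverse of `j` as a `p`-integral rational (and `0` if there is none). -/
def pInv (p : ℕ) [Fact p.Prime] (j : ℕ) : pIntegers p :=
  if h : p ∣ j then 0 else ⟨(j : ℚ)⁻¹, inv_natCast_mem_pIntegers h⟩

theorem coe_pInv {j : ℕ} (hj : ¬ p ∣ j) : (pInv p j : ℚ) = (j : ℚ)⁻¹ := by
  simp [pInv, hj]

theorem natCast_mul_pInv {j : ℕ} (hj : ¬ p ∣ j) : (j : pIntegers p) * pInv p j = 1 := by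
  ext
  have : (j : ℚ) ≠ 0 := by
    rintro h
    simp_all
  simp [coe_pInv hj, this]

theorem ratCongr_of_dvd_sub {m : ℕ} (x y : pIntegers p) (h : (p : pIntegers p) ^ m ∣ x - y) :
    RatCongr p m x y := by
  refine ⟨x.2, y.2, ?_⟩
  obtain ⟨z, hz⟩ := h
  have hz' : (x : ℚ) - y = (p : ℚ) ^ m * z := by
    have := congrArg (Subtype.val) hz
    push_cast at this
    exact_mod_cast this
  rw [hz']
  set w : ℚ := (p : ℚ) ^ m * z with hw
  have hz0 : ((z : ℚ).den : ℚ) ≠ 0 := by exact_mod_cast (z : ℚ).den_ne_zero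
  have hw0 : (w.den : ℚ) ≠ 0 := by exact_mod_cast w.den_ne_zero
  have key : w.num * ((z : ℚ).den : ℤ) = (p : ℤ) ^ m * ((z : ℚ).num * w.den) := by
    have e1 := Rat.num_div_den w
    have e2 := Rat.num_div_den (z : ℚ)
    rw [div_eq_iff hw0] at e1
    rw [div_eq_iff hz0] at e2
    have : (w.num : ℚ) * (z : ℚ).den = (p : ℚ) ^ m * ((z : ℚ).num * w.den) := by
      rw [e1, e2]
      conv_lhs => rw [hw]
      ring
    exact_mod_cast this
  have hc : IsCoprime ((p : ℤ) ^ m) ((z : ℚ).den : ℤ) := by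
    apply IsCoprime.pow_left
    exact Nat.isCoprime_iff_coprime.2 ((Nat.Prime.coprime_iff_not_dvd hp.out).2 z.2)
  exact hc.dvd_of_dvd_mul_right ⟨_, key⟩

end

/-! ### Congruences between harmonic numbers of order `r` at `(p - 1) / 2` -/

section

variable {R : Type*} [CommRing R] {a b q : R}

/-- For a = 1/j and b = 1/(q-j) this is the truncated geometric series of b = -a/(1-qa). -/
theorem pow_five_dvd_inv_add_inv (h : a + b = q * a * b) :
    q ^ 5 ∣ a + b + (q * a ^ 2 + q ^ 2 * a ^ 3 + q ^ 3 * a ^ 4 + q ^ 4 * a ^ 5) :=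
  ⟨a ^ 5 * b, by
    linear_combination (1 + q * a + q ^ 2 * a ^ 2 + q ^ 3 * a ^ 3 + q ^ 4 * a ^ 4) * h⟩

theorem pow_three_dvd_inv_cube_add_inv_cube (h : a + b = q * a * b) :
    q ^ 3 ∣ a ^ 3 + b ^ 3 + (3 * q * a ^ 4 + 6 * q ^ 2 * a ^ 5) := by
  have h1 : b = -a * (1 + q * a + q ^ 2 * a ^ 2) + q ^ 3 * (a ^ 3 * b) := by
    linear_combination (1 + q * a + q ^ 2 * a ^ 2) * h
  obtain ⟨c, hc⟩ : ∃ c, c = a ^ 3 * b := ⟨_, rfl⟩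
  rw [← hc] at h1
  subst h1
  exact ⟨c ^ 3 * q ^ 6 + 3 * c ^ 2 * q ^ 3 * (-a * (1 + q * a + q ^ 2 * a ^ 2)) +
    3 * c * (-a * (1 + q * a + q ^ 2 * a ^ 2)) ^ 2 -
    a ^ 6 * (7 + 6 * q * a + 3 * q ^ 2 * a ^ 2 + q ^ 3 * a ^ 3), by ring⟩

end

section

variable {p : ℕ} [hp : Fact p.Prime]

theorem pInv_add_pInv_sub {j : ℕ} (h1 : 1 ≤ j) (h2 : j < p) :
    pInv p j + pInv p (p - j) = p * pInv p j * pInv p (p - j) := by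
  have e1 := natCast_mul_pInv (not_prime_dvd_of_lt h1 h2)
  have e2 := natCast_mul_pInv (not_prime_dvd_of_lt (p := p) (j := p - j) (by omega) (by omega))
  rw [Nat.cast_sub h2.le] at e2
  linear_combination -pInv p (p - j) * e1 - pInv p j * e2

theorem two_mul_pInv_two_mul {j : ℕ} (h1 : 1 ≤ j) (h2 : 2 * j < p) :
    2 * pInv p (2 * j) = pInv p j := by
  have e1 := natCast_mul_pInv (not_prime_dvd_of_lt h1 (show j < p by omega))
  have e2 := natCast_mul_pInv (not_prime_dvd_of_lt (p := p) (j := 2 * j) (by omega) h2)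
  push_cast at e2
  linear_combination pInv p j * e2 - 2 * pInv p (2 * j) * e1

variable {n : ℕ}

theorem dvd_harmonic_sub_of_two_mul_add_one (hn : p = 2 * n + 1) :
    (p : pIntegers p) ^ 5 ∣ 24 * invPowSum (pInv p) 1 (2 * n) -
      (4 * p ^ 2 * invPowSum (pInv p) 3 n + 6 * p ^ 3 * invPowSum (pInv p) 4 n +
        7 * p ^ 4 * invPowSum (pInv p) 5 n) := by
  have h1 : (p : pIntegers p) ^ 5 ∣ invPowSum (pInv p) 1 (2 * n) +
      (p * invPowSum (pInv p) 2 n + p ^ 2 * invPowSum (pInv p) 3 n +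
        p ^ 3 * invPowSum (pInv p) 4 n + p ^ 4 * invPowSum (pInv p) 5 n) := by
    simp only [invPowSum, pow_one]
    rw [sum_range_two_mul_eq_reflect]
    simp only [mul_sum, ← sum_add_distrib]
    refine dvd_sum fun j hj => ?_
    have := mem_range.1 hj
    rw [← hn]
    exact pow_five_dvd_inv_add_inv (pInv_add_pInv_sub (by omega) (by omega))
  have h2 : (p : pIntegers p) ^ 5 ∣ 32 * invPowSum (pInv p) 1 (2 * n) +
      (8 * p * invPowSum (pInv p) 2 n + 4 * p ^ 2 * invPowSum (pInv p) 3 n +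
        2 * p ^ 3 * invPowSum (pInv p) 4 n + p ^ 4 * invPowSum (pInv p) 5 n) := by
    simp only [invPowSum, pow_one]
    rw [sum_range_two_mul_eq_double]
    simp only [mul_sum, ← sum_add_distrib]
    refine dvd_sum fun j hj => ?_
    have := mem_range.1 hj
    rw [← hn, ← two_mul_pInv_two_mul (p := p) (j := j + 1) (by omega) (by omega)]
    refine (pow_five_dvd_inv_add_inv (pInv_add_pInv_sub (p := p) (j := 2 * (j + 1))
      (by omega) (by omega))).mul_left 32 |>.trans (dvd_of_eq ?_)
    ring
  obtain ⟨c, hc⟩ := h1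
  obtain ⟨d, hd⟩ := h2
  -- The multiplier 8 eliminates H_n^{(2)} between the two pairings.
  exact ⟨d - 8 * c, by linear_combination hd - 8 * hc⟩

theorem dvd_invPowSum_four (hp3 : 3 < p) (hn : p = 2 * n + 1) :
    (p : pIntegers p) ^ 2 ∣ 15 * invPowSum (pInv p) 4 n + 31 * p * invPowSum (pInv p) 5 n := by
  have h1 : (p : pIntegers p) ^ 3 ∣ invPowSum (pInv p) 3 (2 * n) +
      (3 * p * invPowSum (pInv p) 4 n + 6 * p ^ 2 * invPowSum (pInv p) 5 n) := by
    simp only [invPowSum]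
    rw [sum_range_two_mul_eq_reflect (fun k => pInv p k ^ 3)]
    simp only [mul_sum, ← sum_add_distrib]
    refine dvd_sum fun j hj => ?_
    have := mem_range.1 hj
    rw [← hn]
    exact pow_three_dvd_inv_cube_add_inv_cube (pInv_add_pInv_sub (by omega) (by omega))
  have h2 : (p : pIntegers p) ^ 3 ∣ 32 * invPowSum (pInv p) 3 (2 * n) +
      (6 * p * invPowSum (pInv p) 4 n + 6 * p ^ 2 * invPowSum (pInv p) 5 n) := by
    simp only [invPowSum]
    rw [sum_range_two_mul_eq_double (fun k => pInv p k ^ 3)]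
    simp only [mul_sum, ← sum_add_distrib]
    refine dvd_sum fun j hj => ?_
    have := mem_range.1 hj
    rw [← hn, ← two_mul_pInv_two_mul (p := p) (j := j + 1) (by omega) (by omega)]
    refine (pow_three_dvd_inv_cube_add_inv_cube (pInv_add_pInv_sub (p := p) (j := 2 * (j + 1))
      (by omega) (by omega))).mul_left 32 |>.trans (dvd_of_eq ?_)
    ring
  obtain ⟨c, hc⟩ := h1
  obtain ⟨d, hd⟩ := h2
  have h6 : (6 : pIntegers p) * pInv p 6 = 1 := by
    have : ¬ p ∣ 6 := by
      rw [show 6 = 2 * 3 by norm_num, hp.out.dvd_mul]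
      rintro (h | h) <;> have := Nat.le_of_dvd (by norm_num) h <;> omega
    exact_mod_cast natCast_mul_pInv this
  -- Eliminating H_{p-1}^{(3)} leaves 6p times the claimed expression; 6 is a unit and one factor p
  -- cancels.
  refine ⟨pInv p 6 * (32 * c - d), mul_left_cancel₀ prime_cast_ne_zero ?_⟩
  linear_combination pInv p 6 * (32 * hc - hd) - p * (15 * invPowSum (pInv p) 4 n +
    31 * p * invPowSum (pInv p) 5 n) * h6

end

/-! ### Power sums and Bernoulli numbers modulo `p` -/

section

variable {p : ℕ} [hp : Fact p.Prime] {n : ℕ}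

/-- The recursion for B_i divides only by i+1, which is less than p. -/
theorem bernoulli_mem_pIntegers (i : ℕ) (hi : i + 1 < p) : bernoulli i ∈ pIntegers p := by
  induction i using Nat.strong_induction_on with
  | _ i ih =>
    have h := sum_bernoulli (i + 1)
    rw [sum_range_succ, Nat.choose_succ_self_right] at h
    have h0 : ((i + 1 : ℕ) : ℚ) ≠ 0 := by positivity
    have e : bernoulli i = ((i + 1 : ℕ) : ℚ)⁻¹ * ((if i + 1 = 1 then 1 else 0) -
        ∑ k ∈ range i, ((i + 1).choose k : ℚ) * bernoulli k) := by
      rw [← h, add_sub_cancel_left, inv_mul_cancel_left₀ h0]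
    rw [e]
    refine mul_mem (inv_natCast_mem_pIntegers (not_prime_dvd_of_lt (by omega) hi))
      (sub_mem ?_ (sum_mem fun k hk => ?_))
    · split_ifs
      exacts [one_mem _, zero_mem _]
    · have := mem_range.1 hk
      exact mul_mem (natCast_mem _ _) (ih k this (by omega))

/-- The Bernoulli number `B_i` as a `p`-integral rational (and `0` if it is not `p`-integral). -/
def pBernoulli (p : ℕ) [Fact p.Prime] (i : ℕ) : pIntegers p :=
  if h : ¬ p ∣ (bernoulli i).den then ⟨bernoulli i, mem_pIntegers.2 h⟩ else 0

theorem coe_pBernoulli {i : ℕ} (hi : i + 1 < p) : (pBernoulli p i : ℚ) = bernoulli i := by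
  rw [pBernoulli, dif_pos (mem_pIntegers.1 (bernoulli_mem_pIntegers i hi))]

theorem mul_sum_range_pow_eq_pBernoulli (m : ℕ) {q : ℕ} (hq : q + 1 < p) :
    ((q + 1 : ℕ) : pIntegers p) * ∑ k ∈ range m, (k : pIntegers p) ^ q =
      ∑ i ∈ range (q + 1), pBernoulli p i * ((q + 1).choose i) * (m : pIntegers p) ^ (q + 1 - i) := by
  ext
  have h := sum_range_pow m q
  rw [← sum_div, eq_div_iff (by positivity)] at h
  push_cast
  rw [mul_comm, h]
  refine sum_congr rfl fun i hi => ?_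
  have := mem_range.1 hi
  rw [coe_pBernoulli (by omega)]

/-- In Faulhaber's formula at p, every term except that of B_m carries at least p^2. -/
theorem dvd_sum_range_pow_sub {m : ℕ} (hm : m + 1 < p) :
    (p : pIntegers p) ^ 2 ∣ ∑ k ∈ range p, (k : pIntegers p) ^ m - p * pBernoulli p m := by
  have h := mul_sum_range_pow_eq_pBernoulli p hm
  have h1 := natCast_mul_pInv (not_prime_dvd_of_lt (p := p) (j := m + 1) (by omega) hm)
  rw [sum_range_succ, Nat.choose_succ_self_right, Nat.add_sub_cancel_left, pow_one] at h
  have h2 : (p : pIntegers p) ^ 2 ∣ ∑ i ∈ range m,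
      pBernoulli p i * ((m + 1).choose i) * (p : pIntegers p) ^ (m + 1 - i) :=
    dvd_sum fun i hi => Dvd.dvd.mul_left (pow_dvd_pow _ (by have := mem_range.1 hi; omega)) _
  obtain ⟨c, hc⟩ := h2
  refine ⟨pInv p (m + 1) * c, ?_⟩
  linear_combination pInv p (m + 1) * (h + hc) -
    (∑ k ∈ range p, (k : pIntegers p) ^ m - p * pBernoulli p m) * h1

theorem sq_dvd_pow_add_pow_sub {R : Type*} [CommRing R] (x q : R) {m : ℕ} (hm : Even m) :
    q ^ 2 ∣ x ^ m + (q - x) ^ m - (2 * x ^ m - m * q * x ^ (m - 1)) := by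
  obtain ⟨c, hc⟩ := Polynomial.powAddExpansion x (-q) m
  refine ⟨c, ?_⟩
  rw [← neg_sub x q, hm.neg_pow, sub_eq_add_neg x q, hc]
  ring

/-- The m-th power sum over 1, …, p-1 is about p B_m modulo p^2. Evaluating it by both pairings and
eliminating ∑_{j ≤ n} j^m leaves a relation divisible by p^2, from which one p cancels. -/
theorem dvd_mul_pBernoulli_add (hn : p = 2 * n + 1) {m : ℕ} (hm : Even m) (hm0 : m ≠ 0)
    (hmp : m + 1 < p) :
    (p : pIntegers p) ∣ (2 ^ m - 1) * pBernoulli p m +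
      m * 2 ^ (m - 1) * ∑ j ∈ range n, ((j + 1 : ℕ) : pIntegers p) ^ (m - 1) := by
  have hs : ∑ k ∈ range p, (k : pIntegers p) ^ m =
      ∑ k ∈ range (2 * n), ((k + 1 : ℕ) : pIntegers p) ^ m := by
    have h : range p = range (2 * n + 1) := by rw [hn]
    rw [h, sum_range_succ']
    simp [hm0]
  have h0 := dvd_sum_range_pow_sub (p := p) hmp
  rw [hs] at h0
  have h1 : (p : pIntegers p) ^ 2 ∣ ∑ k ∈ range (2 * n), ((k + 1 : ℕ) : pIntegers p) ^ m -
      (2 * ∑ j ∈ range n, ((j + 1 : ℕ) : pIntegers p) ^ m -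
        m * p * ∑ j ∈ range n, ((j + 1 : ℕ) : pIntegers p) ^ (m - 1)) := by
    rw [sum_range_two_mul_eq_reflect (fun k => (k : pIntegers p) ^ m)]
    simp only [mul_sum, ← sum_sub_distrib]
    refine dvd_sum fun j hj => ?_
    have := mem_range.1 hj
    rw [← hn, Nat.cast_sub (by omega)]
    exact sq_dvd_pow_add_pow_sub _ _ hm
  have h2 : (p : pIntegers p) ^ 2 ∣ ∑ k ∈ range (2 * n), ((k + 1 : ℕ) : pIntegers p) ^ m -
      (2 * 2 ^ m * ∑ j ∈ range n, ((j + 1 : ℕ) : pIntegers p) ^ m -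
        m * p * 2 ^ (m - 1) * ∑ j ∈ range n, ((j + 1 : ℕ) : pIntegers p) ^ (m - 1)) := by
    rw [sum_range_two_mul_eq_double (fun k => (k : pIntegers p) ^ m)]
    simp only [mul_sum, ← sum_sub_distrib]
    refine dvd_sum fun j hj => ?_
    have := mem_range.1 hj
    rw [← hn, Nat.cast_sub (by omega)]
    refine (sq_dvd_pow_add_pow_sub ((2 * (j + 1) : ℕ) : pIntegers p) _ hm).trans (dvd_of_eq ?_)
    push_cast
    simp only [mul_pow]
    ring
  obtain ⟨c, hc⟩ := h0
  obtain ⟨d, hd⟩ := h1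
  obtain ⟨e, he⟩ := h2
  have h2m : (2 : pIntegers p) ^ m = 2 * 2 ^ (m - 1) := by
    rw [← pow_succ']
    congr 1
    omega
  refine ⟨2 ^ m * d - e - (2 ^ m - 1) * c, mul_left_cancel₀ prime_cast_ne_zero ?_⟩
  linear_combination 2 ^ m * hd - he - (2 ^ m - 1) * hc -
    m * p * (∑ j ∈ range n, ((j + 1 : ℕ) : pIntegers p) ^ (m - 1)) * h2m

/-! ### Consequences in `ZMod p` -/

/-- The inverse of `j` in `ZMod p`, as a function of the natural number `j`. -/
def zInv (p : ℕ) [Fact p.Prime] (j : ℕ) : ZMod p := pReduce p (pInv p j)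

theorem natCast_mul_zInv {j : ℕ} (h1 : 1 ≤ j) (h2 : j < p) : (j : ZMod p) * zInv p j = 1 := by
  rw [zInv, ← map_natCast (pReduce p), ← map_mul, natCast_mul_pInv (not_prime_dvd_of_lt h1 h2),
    map_one]

theorem zInv_pow_eq {j : ℕ} (h1 : 1 ≤ j) (h2 : j < p) {r : ℕ} (hr : r ≤ p - 1) :
    zInv p j ^ r = (j : ZMod p) ^ (p - 1 - r) := by
  have h := natCast_mul_zInv h1 h2
  have h0 : (j : ZMod p) ≠ 0 := left_ne_zero_of_mul_eq_one h
  have h3 := ZMod.pow_card_sub_one_eq_one h0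
  rw [← Nat.sub_add_cancel hr, pow_add] at h3
  have h4 : (j : ZMod p) ^ r * zInv p j ^ r = 1 := by rw [← mul_pow, h, one_pow]
  linear_combination (j : ZMod p) ^ (p - 1 - r) * h4 - zInv p j ^ r * h3

theorem sum_range_natCast_pow (hn : p = 2 * n + 1) (i : ℕ) :
    ∑ k ∈ range (2 * n), ((k + 1 : ℕ) : ZMod p) ^ i = if 2 * n ∣ i then -1 else 0 := by
  have h := FiniteField.sum_pow_units (ZMod p) i
  rw [ZMod.card, show p - 1 = 2 * n by omega] at h
  rw [← h]
  refine sum_bij' (fun v hv ↦ Units.mk0 ((v + 1 : ℕ) : ZMod p)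
      (left_ne_zero_of_mul_eq_one (natCast_mul_zInv (by omega)
        (by have := mem_range.1 hv; omega))))
    (fun u _ ↦ (u : ZMod p).val - 1) (fun _ _ ↦ mem_univ _) (fun u _ ↦ ?_) (fun v hv ↦ ?_)
    (fun u _ ↦ Units.ext ?_) (fun _ _ ↦ rfl)
  · have h1 := ZMod.val_lt (u : ZMod p)
    have h2 := (ZMod.val_ne_zero (u : ZMod p)).2 u.ne_zero
    rw [mem_range]
    omega
  · have := mem_range.1 hv
    simp only [Units.val_mk0]
    rw [ZMod.val_cast_of_lt (by omega), Nat.add_sub_cancel]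
  · have h2 := (ZMod.val_ne_zero (u : ZMod p)).2 u.ne_zero
    simp only [Units.val_mk0]
    rw [Nat.sub_add_cancel (by omega), ZMod.natCast_zmod_val]

theorem invPowSum_zInv_eq_zero (hn : p = 2 * n + 1) {r : ℕ} (hr0 : 0 < r) (hr : r < 2 * n) :
    invPowSum (zInv p) r (2 * n) = 0 := by
  have h := sum_range_natCast_pow hn (2 * n - r)
  rw [if_neg (Nat.not_dvd_of_pos_of_lt (by omega) (by omega))] at h
  rw [← h]
  refine sum_congr rfl fun k hk => ?_
  have := mem_range.1 hk
  rw [zInv_pow_eq (by omega) (by omega) (by omega)]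
  congr 1
  omega

theorem zInv_sub (hn : p = 2 * n + 1) {j : ℕ} (h1 : 1 ≤ j) (h2 : j < p) :
    zInv p (p - j) = -zInv p j := by
  have e1 := natCast_mul_zInv h1 h2
  have e2 := natCast_mul_zInv (p := p) (j := p - j) (by omega) (by omega)
  rw [Nat.cast_sub h2.le, CharP.cast_eq_zero] at e2
  linear_combination -zInv p (p - j) * e1 - zInv p j * e2

theorem natCast_ne_zero_of_lt {j : ℕ} (h1 : 1 ≤ j) (h2 : j < p) : (j : ZMod p) ≠ 0 :=
  left_ne_zero_of_mul_eq_one (natCast_mul_zInv h1 h2)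

theorem invPowSum_two_zInv_half_eq_zero (hn : p = 2 * n + 1) (hp3 : 3 < p) :
    invPowSum (zInv p) 2 n = 0 := by
  have h := invPowSum_zInv_eq_zero hn (r := 2) (by omega) (by omega)
  rw [invPowSum, sum_range_two_mul_eq_reflect (fun k => zInv p k ^ 2)] at h
  have h2 : ∀ j ∈ range n, zInv p (j + 1) ^ 2 + zInv p (2 * n + 1 - (j + 1)) ^ 2 =
      2 * zInv p (j + 1) ^ 2 := by
    intro j hj
    have := mem_range.1 hj
    rw [← hn, zInv_sub hn (by omega) (by omega)]
    ring
  rw [sum_congr rfl h2, ← mul_sum] at h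
  exact (mul_eq_zero.1 h).resolve_left
    (by exact_mod_cast natCast_ne_zero_of_lt (p := p) (j := 2) (by omega) (by omega))

theorem invPowSum_five_zInv (hn : p = 2 * n + 1) (hp5 : 5 < p) :
    invPowSum (zInv p) 5 n = -6 * pReduce p (pBernoulli p (p - 5)) := by
  have h := dvd_mul_pBernoulli_add hn (m := p - 5) ⟨n - 2, by omega⟩ (by omega) (by omega)
  obtain ⟨c, hc⟩ := h
  have h1 := congrArg (pReduce p) hc
  simp only [map_add, map_sub, map_mul, map_pow, map_one, map_natCast, map_sum, map_ofNat,
    CharP.cast_eq_zero, zero_mul] at h1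
  have e1 : ∑ j ∈ range n, ((j + 1 : ℕ) : ZMod p) ^ (p - 5 - 1) = invPowSum (zInv p) 5 n := by
    refine sum_congr rfl fun k hk => ?_
    have := mem_range.1 hk
    rw [zInv_pow_eq (by omega) (by omega) (by omega), Nat.sub_sub, Nat.sub_sub]
  rw [e1] at h1
  have h2 : (2 : ZMod p) ≠ 0 := by
    exact_mod_cast natCast_ne_zero_of_lt (p := p) (j := 2) (by omega) (by omega)
  have h5 : (5 : ZMod p) ≠ 0 := by
    exact_mod_cast natCast_ne_zero_of_lt (p := p) (j := 5) (by omega) (by omega)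
  -- By Fermat 2^(p-6) = 1/32, so the relation reads -(15/16) B_{p-5} - (5/32) H_n^{(5)} = 0.
  have e2 : (2 : ZMod p) ^ (p - 5 - 1) * 32 = 1 := by
    rw [show (32 : ZMod p) = 2 ^ 5 by norm_num, ← pow_add, show p - 5 - 1 + 5 = p - 1 by omega]
    exact ZMod.pow_card_sub_one_eq_one h2
  have e3 : (2 : ZMod p) ^ (p - 5) = 2 * 2 ^ (p - 5 - 1) := by
    rw [← pow_succ']
    congr 1
    omega
  have e4 : ((p - 5 : ℕ) : ZMod p) = -5 := by
    rw [Nat.cast_sub hp5.le]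
    simp
  rw [e3, e4] at h1
  refine mul_left_cancel₀ h5 ?_
  linear_combination (2 * pReduce p (pBernoulli p (p - 5)) - 5 * invPowSum (zInv p) 5 n) * e2 -
    32 * h1

/-- `∑_{k=1}^N H_k^{(2)} / k^3`. -/
def nestedSum (p : ℕ) [Fact p.Prime] (N : ℕ) : ZMod p :=
  ∑ k ∈ range N, invPowSum (zInv p) 2 (k + 1) * zInv p (k + 1) ^ 3

/-- By Fermat H_k^{(2)} is a sum of (p-3)-th powers, hence a polynomial in k by Faulhaber. Summing
over all nonzero residues keeps only the exponent p-1, that is i = p-5, with binomial coefficient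
C(p-2, 3) ≡ -4. -/
theorem nestedSum_two_mul (hn : p = 2 * n + 1) (hp5 : 5 < p) :
    nestedSum p (2 * n) = -2 * pReduce p (pBernoulli p (p - 5)) := by
  have hF : ∀ k ∈ range (2 * n), -2 * invPowSum (zInv p) 2 k =
      ∑ i ∈ range (p - 2), pReduce p (pBernoulli p i) * ((p - 2).choose i) *
        ((k + 1 : ℕ) : ZMod p) ^ (p - 2 - i) := by
    intro k hk
    have hk := mem_range.1 hk
    have h := congrArg (pReduce p)
      (mul_sum_range_pow_eq_pBernoulli (p := p) (k + 1) (q := p - 3) (by omega))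
    simp only [map_mul, map_pow, map_natCast, map_sum] at h
    rw [show p - 3 + 1 = p - 2 by omega, Nat.cast_sub (by omega), CharP.cast_eq_zero,
      sum_range_succ', Nat.cast_zero, zero_pow (by omega), add_zero] at h
    rw [← h, invPowSum]
    congr 1
    · simp
    · refine sum_congr rfl fun j hj => ?_
      have := mem_range.1 hj
      rw [zInv_pow_eq (by omega) (by omega) (by omega), Nat.sub_sub]
  have h1 : -2 * nestedSum p (2 * n) = ∑ k ∈ range (2 * n), ∑ i ∈ range (p - 2),
      pReduce p (pBernoulli p i) * ((p - 2).choose i) *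
        ((k + 1 : ℕ) : ZMod p) ^ (2 * p - 6 - i) := by
    -- H_{k+1}^{(2)} may be replaced by H_k^{(2)}: the total change is H_{p-1}^{(5)} ≡ 0.
    have h5 := invPowSum_zInv_eq_zero hn (r := 5) (by omega) (by omega)
    have : nestedSum p (2 * n) = ∑ k ∈ range (2 * n),
        invPowSum (zInv p) 2 k * zInv p (k + 1) ^ 3 := by
      rw [← sub_eq_zero, nestedSum, ← sum_sub_distrib, ← h5]
      refine sum_congr rfl fun k _ => ?_
      rw [invPowSum, sum_range_succ, ← invPowSum]
      ring
    rw [this, mul_sum]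
    refine sum_congr rfl fun k hk => ?_
    rw [← mul_assoc, hF k hk, sum_mul]
    have hk := mem_range.1 hk
    refine sum_congr rfl fun i hi => ?_
    have hi := mem_range.1 hi
    rw [zInv_pow_eq (by omega) (by omega) (by omega), mul_assoc, ← pow_add]
    congr 2
    omega
  rw [sum_comm] at h1
  simp only [← mul_sum, sum_range_natCast_pow hn] at h1
  rw [sum_eq_single (p - 5)] at h1
  · rw [if_pos ⟨1, by omega⟩, show p - 2 = (p - 5) + 3 by omega, Nat.choose_symm_add] at h1
    have h6 := Nat.descFactorial_eq_factorial_mul_choose (p - 5 + 3) 3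
    have e : (p - 5 + 3).descFactorial 3 = (p - 2) * ((p - 3) * (p - 4)) := by
      simp only [Nat.descFactorial]
      rw [show p - 5 + 3 - 0 = p - 2 by omega, show p - 5 + 3 - 1 = p - 3 by omega,
        show p - 5 + 3 - 2 = p - 4 by omega]
      ring
    have h7 := congrArg (Nat.cast (R := ZMod p)) (e.symm.trans h6)
    push_cast [Nat.factorial] at h7
    rw [Nat.cast_sub (by omega), Nat.cast_sub (by omega), Nat.cast_sub (by omega),
      CharP.cast_eq_zero] at h7
    have h12 : (12 : ZMod p) ≠ 0 := by
      have h2 : (2 : ZMod p) ≠ 0 := by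
        exact_mod_cast natCast_ne_zero_of_lt (p := p) (j := 2) (by omega) (by omega)
      have h3 : (3 : ZMod p) ≠ 0 := by
        exact_mod_cast natCast_ne_zero_of_lt (p := p) (j := 3) (by omega) (by omega)
      rw [show (12 : ZMod p) = 2 * 2 * 3 by norm_num]
      exact mul_ne_zero (mul_ne_zero h2 h2) h3
    refine mul_left_cancel₀ h12 ?_
    push_cast at h7
    linear_combination -6 * h1 - pReduce p (pBernoulli p (p - 5)) * h7
  · intro i hi hne
    have hi := mem_range.1 hi
    rw [if_neg, mul_zero]
    rintro ⟨c, hc⟩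
    have h2 : c < 2 := by
      by_contra! h
      have := Nat.mul_le_mul_left (2 * n) h
      omega
    interval_cases c <;> omega
  · intro h
    exact absurd (mem_range.2 (by omega)) h

/-- Modulo p, H_{p-k}^{(2)} ≡ -H_{k-1}^{(2)}, so the terms at k and p-k add up to 2 H_k^{(2)}/k^3 -
1/k^5. -/
theorem nestedSum_half (hn : p = 2 * n + 1) (hp5 : 5 < p) :
    nestedSum p n = -4 * pReduce p (pBernoulli p (p - 5)) := by
  have h := nestedSum_two_mul hn hp5
  have h5 := invPowSum_five_zInv hn hp5
  rw [nestedSum, sum_range_two_mul_eq_reflect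
    (fun k => invPowSum (zInv p) 2 k * zInv p k ^ 3)] at h
  have hH : ∀ j < n, invPowSum (zInv p) 2 (2 * n + 1 - (j + 1)) = -invPowSum (zInv p) 2 j := by
    intro j hj
    have h0 := invPowSum_zInv_eq_zero hn (r := 2) (by omega) (by omega)
    rw [invPowSum, show 2 * n = (2 * n - j) + j by omega, sum_range_add, ← invPowSum] at h0
    rw [show 2 * n + 1 - (j + 1) = 2 * n - j by omega, eq_neg_iff_add_eq_zero, ← h0]
    congr 1
    rw [invPowSum, ← sum_range_reflect]
    refine sum_congr rfl fun i hi => ?_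
    have hi := mem_range.1 hi
    rw [← neg_sq, ← zInv_sub hn (by omega) (by omega)]
    congr 2
    omega
  have h2 : ∀ j ∈ range n, invPowSum (zInv p) 2 (j + 1) * zInv p (j + 1) ^ 3 +
      invPowSum (zInv p) 2 (2 * n + 1 - (j + 1)) * zInv p (2 * n + 1 - (j + 1)) ^ 3 =
      2 * (invPowSum (zInv p) 2 (j + 1) * zInv p (j + 1) ^ 3) - zInv p (j + 1) ^ 5 := by
    intro j hj
    have := mem_range.1 hj
    rw [hH j this, ← hn, zInv_sub hn (by omega) (by omega), invPowSum, invPowSum, sum_range_succ]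
    ring
  rw [sum_congr rfl h2, sum_sub_distrib, ← mul_sum, ← nestedSum, ← invPowSum, h5] at h
  have h2 : (2 : ZMod p) ≠ 0 := by
    exact_mod_cast natCast_ne_zero_of_lt (p := p) (j := 2) (by omega) (by omega)
  refine mul_left_cancel₀ h2 ?_
  linear_combination h

end

/-! ### The derivative of `shiftSum` modulo `p` -/

section

open Polynomial

variable {p : ℕ} [hp : Fact p.Prime] {n : ℕ}

/-- `zInv` with values in the constant polynomials. -/
noncomputable def polyInv (p : ℕ) [Fact p.Prime] (j : ℕ) : (ZMod p)[X] := C (zInv p j)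

theorem natCast_mul_polyInv {j : ℕ} (h1 : 1 ≤ j) (h2 : j < p) :
    (j : (ZMod p)[X]) * polyInv p j = 1 := by
  rw [polyInv, ← C_eq_natCast, ← C_mul, natCast_mul_zInv h1 h2, C_1]

theorem invPowSum_polyInv (r N : ℕ) : invPowSum (polyInv p) r N = C (invPowSum (zInv p) r N) :=
  (map_invPowSum C _ _ _).symm

theorem sineProd_zInv_eq_zero (hn : p = 2 * n + 1) {x : ZMod p} (hx : x ≠ 0) :
    sineProd (zInv p) x n = 0 := by
  have h1 := ZMod.val_lt x
  have h2 := (ZMod.val_ne_zero x).2 hx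
  have h3 := natCast_mul_zInv (p := p) (j := x.val) (by omega) h1
  rw [ZMod.natCast_zmod_val] at h3
  by_cases h : x.val ≤ n
  · refine prod_eq_zero (i := x.val - 1) (mem_range.2 (by omega)) ?_
    rw [Nat.sub_add_cancel (by omega)]
    linear_combination (-x * zInv p x.val - 1) * h3
  · refine prod_eq_zero (i := p - x.val - 1) (mem_range.2 (by omega)) ?_
    rw [Nat.sub_add_cancel (by omega), zInv_sub hn (by omega) h1]
    linear_combination (-x * zInv p x.val - 1) * h3

/-- Both sides have degree at most p-1 and agree at all p elements of `ZMod p`. -/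
theorem sineProd_polyInv_half (hn : p = 2 * n + 1) :
    sineProd (polyInv p) X n = 1 - X ^ (2 * n) := by
  have hp2 := hp.out.two_le
  have hdeg : (sineProd (polyInv p) X n).natDegree ≤ 2 * n := by
    refine (natDegree_prod_le _ _).trans ?_
    rw [mul_comm, ← smul_eq_mul, ← card_range n, ← sum_const, card_range]
    refine sum_le_sum fun i _ => ?_
    rw [polyInv, ← C_pow]
    compute_degree
  refine eq_of_degree_sub_lt_of_eval_finset_eq univ ?_ fun x _ => ?_
  · rw [card_univ, ZMod.card]
    refine degree_le_natDegree.trans_lt (Nat.cast_lt.2 ?_)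
    refine (natDegree_sub_le_of_le hdeg (n := 2 * n) ?_).trans_lt (by simp; omega)
    compute_degree
  · have e : eval x (sineProd (polyInv p) X n) = sineProd (zInv p) x n := by
      have := map_sineProd (evalRingHom x) (polyInv p) X n
      simpa [polyInv] using this
    rw [e]
    by_cases hx : x = 0
    · subst hx
      have : n ≠ 0 := by omega
      simp [sineProd, this]
    · rw [sineProd_zInv_eq_zero hn hx]
      have := ZMod.pow_card_sub_one_eq_one hx
      rw [show p - 1 = 2 * n by omega] at this
      simp [this]

theorem sineProd_polyInv_two_mul (hn : p = 2 * n + 1) :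
    sineProd (polyInv p) X (2 * n) = (1 - X ^ (2 * n)) ^ 2 := by
  rw [← sineProd_polyInv_half hn, sineProd, sineProd, ← prod_pow,
    prod_range_two_mul_eq_reflect (fun k => 1 - X ^ 2 * polyInv p k ^ 2)]
  refine prod_congr rfl fun j hj => ?_
  have := mem_range.1 hj
  rw [← hn, polyInv, polyInv, zInv_sub hn (by omega) (by omega), C_neg, neg_sq]
  ring

theorem shiftSum_comp (N : ℕ) : (shiftSum (polyInv p) (X * (X + 1)) N).comp (X - 1) =
    shiftSum (polyInv p) ((X - 1) * X) N := by
  have h := map_shiftSum (compRingHom (X - 1)) (polyInv p) (X * (X + 1)) N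
  have e : polyInv p = fun j => C (zInv p j) := rfl
  simpa [e] using h

theorem shiftSum_half_sub_comp (hn : p = 2 * n + 1) (hp3 : 3 < p) :
    shiftSum (polyInv p) (X * (X + 1)) n - (shiftSum (polyInv p) (X * (X + 1)) n).comp (X - 1) =
      -2 * X ^ (p - 4) := by
  have h := shiftSum_sub (ι := polyInv p) (N := n)
    (fun j h1 h2 => natCast_mul_polyInv h1 (by omega)) X
  rw [invPowSum_polyInv, invPowSum_two_zInv_half_eq_zero hn hp3, sineProd_polyInv_half hn] at h
  rw [shiftSum_comp]
  refine mul_left_cancel₀ (pow_ne_zero 3 X_ne_zero) ?_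
  rw [h, show 2 * n = 3 + (p - 4) by omega, pow_add, C_0]
  ring

theorem shiftSum_two_mul_sub_comp (hn : p = 2 * n + 1) (hp3 : 3 < p) :
    shiftSum (polyInv p) (X * (X + 1)) (2 * n) -
      (shiftSum (polyInv p) (X * (X + 1)) (2 * n)).comp (X - 1) =
      2 * X ^ (2 * p - 5) - 4 * X ^ (p - 4) := by
  have h := shiftSum_sub (ι := polyInv p) (N := 2 * n)
    (fun j h1 h2 => natCast_mul_polyInv h1 (by omega)) X
  rw [invPowSum_polyInv, invPowSum_zInv_eq_zero hn (by omega) (by omega),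
    sineProd_polyInv_two_mul hn] at h
  rw [shiftSum_comp]
  refine mul_left_cancel₀ (pow_ne_zero 3 X_ne_zero) ?_
  rw [h, show 2 * n = 3 + (p - 4) by omega, show 2 * p - 5 = (p - 4) + (p - 4) + 3 by omega,
    pow_add, pow_add, pow_add, C_0]
  ring

/-- With K = k+1, the product is -x/K - x^2/K^2 + O(x^3). -/
theorem eval_shiftProd_derivatives (k : ℕ) (hk : k + 1 < p) :
    eval 0 (shiftProd (polyInv p) (X * (X + 1)) (k + 1)) = 0 ∧
    eval 0 (derivative (shiftProd (polyInv p) (X * (X + 1)) (k + 1))) = -zInv p (k + 1) ∧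
    eval 0 (derivative (derivative (shiftProd (polyInv p) (X * (X + 1)) (k + 1)))) =
      -2 * zInv p (k + 1) ^ 2 := by
  induction k with
  | zero =>
    have h := natCast_mul_zInv (p := p) (j := 1) le_rfl (by omega)
    rw [Nat.cast_one, one_mul] at h
    refine ⟨by simp [shiftProd], by simp [shiftProd, polyInv, h], ?_⟩
    simp [shiftProd, polyInv, h]
    norm_num
  | succ k ih =>
    obtain ⟨h0, h1, h2⟩ := ih (by omega)
    have e1 := natCast_mul_zInv (p := p) (j := k + 1) (by omega) (by omega)
    have e2 := natCast_mul_zInv (p := p) (j := k + 1 + 1) (by omega) (by omega)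
    push_cast at e1 e2
    rw [shiftProd, prod_range_succ, ← shiftProd]
    refine ⟨by simp [h0], ?_, ?_⟩
    · simp [h0, h1, polyInv]
      linear_combination zInv p (k + 2) * e2 + zInv p (k + 2) ^ 2 * (k + 2) * e1
    · simp [h0, h1, h2, polyInv, derivative_pow]
      linear_combination (-2 * zInv p (k + 1) * (k + 2) - 2) * zInv p (k + 2) ^ 2 * e1

theorem eval_zero_derivative_two_shiftSum (N : ℕ) (hN : N < p) :
    eval 0 (derivative (derivative (shiftSum (polyInv p) (X * (X + 1)) N))) =
      -2 * nestedSum p N := by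
  rw [shiftSum, nestedSum, derivative_sum, derivative_sum, eval_finsetSum, mul_sum]
  refine sum_congr rfl fun k hk => ?_
  have := mem_range.1 hk
  rw [invPowSum_polyInv, polyInv, ← C_mul, derivative_C_mul, derivative_C_mul, eval_C_mul,
    (eval_shiftProd_derivatives k (by omega)).2.2]
  ring

/-- Differentiating S(x) - S(x-1) = D(x) twice and telescoping over x = 1, …, m. -/
theorem eval_derivative_two_of_sub_comp {S D : (ZMod p)[X]} (h : S - S.comp (X - 1) = D)
    {c : ZMod p} (m : ℕ) (hD : ∀ j < m, eval ((j + 1 : ℕ) : ZMod p) (derivative (derivative D)) =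
      c * zInv p (j + 1) ^ 5) :
    eval (m : ZMod p) (derivative (derivative S)) =
      eval 0 (derivative (derivative S)) + c * invPowSum (zInv p) 5 m := by
  induction m with
  | zero => simp [invPowSum]
  | succ m ih =>
    have h1 := hD m (by omega)
    rw [← h] at h1
    simp [derivative_comp] at h1
    rw [ih fun j hj => hD j (by omega)] at h1
    rw [invPowSum, sum_range_succ, ← invPowSum]
    push_cast
    linear_combination h1

/-- The chain rule also yields (2n+1)^2 times a second derivative, which vanishes as 2n+1 = p. -/
theorem eval_derivative_two_comp (hn : p = 2 * n + 1) (N : ℕ) :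
    eval (n : ZMod p) (derivative (derivative (shiftSum (polyInv p) (X * (X + 1)) N))) =
      2 * eval ((n : ZMod p) * (n + 1)) (derivative (shiftSum (polyInv p) X N)) := by
  have h := map_shiftSum (compRingHom (X * (X + 1))) (polyInv p) X N
  have e : polyInv p = fun j => C (zInv p j) := rfl
  have h0 : shiftSum (polyInv p) (X * (X + 1)) N =
      (shiftSum (polyInv p) X N).comp (X * (X + 1)) := by
    simpa [e] using h.symm
  have h1 : (2 * n + 1 : ZMod p) = 0 := by
    have := CharP.cast_eq_zero (ZMod p) p
    rw [← this, ← Nat.cast_ofNat, ← Nat.cast_mul, ← Nat.cast_add_one, ← hn]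
  rw [h0]
  simp [derivative_comp]
  linear_combination (2 * (n : ZMod p) + 1) * eval ((n : ZMod p) * (n + 1))
    (derivative (derivative (shiftSum (polyInv p) X N))) * h1

theorem eval_derivative_shiftSum_half (hn : p = 2 * n + 1) (hp5 : 5 < p) :
    eval ((n : ZMod p) * (n + 1)) (derivative (shiftSum (polyInv p) X n)) =
      124 * pReduce p (pBernoulli p (p - 5)) := by
  have h2 : (2 : ZMod p) ≠ 0 := by
    exact_mod_cast natCast_ne_zero_of_lt (p := p) (j := 2) (by omega) (by omega)
  refine mul_left_cancel₀ h2 ?_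
  rw [← eval_derivative_two_comp hn,
    -- -40 = -2·(-4)·(-5), from differentiating -2 X^(p-4) twice.
    eval_derivative_two_of_sub_comp (shiftSum_half_sub_comp hn (by omega)) (c := -40) n,
    eval_zero_derivative_two_shiftSum n (by omega), nestedSum_half hn hp5,
    invPowSum_five_zInv hn hp5]
  · ring
  · intro j hj
    have e1 : ((p - 4 : ℕ) : ZMod p) = -4 := by
      rw [Nat.cast_sub (by omega)]
      simp
    have e2 : ((p - 4 - 1 : ℕ) : ZMod p) = -5 := by
      rw [Nat.sub_sub, Nat.cast_sub (by omega)]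
      simp
    rw [zInv_pow_eq (by omega) (by omega) (by omega), show p - 1 - 5 = p - 4 - 1 - 1 by omega]
    simp [e1, e2, derivative_X_pow]
    ring

theorem eval_derivative_shiftSum_two_mul (hn : p = 2 * n + 1) (hp5 : 5 < p) :
    eval ((n : ZMod p) * (n + 1)) (derivative (shiftSum (polyInv p) X (2 * n))) =
      62 * pReduce p (pBernoulli p (p - 5)) := by
  have h2 : (2 : ZMod p) ≠ 0 := by
    exact_mod_cast natCast_ne_zero_of_lt (p := p) (j := 2) (by omega) (by omega)
  refine mul_left_cancel₀ h2 ?_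
  rw [← eval_derivative_two_comp hn,
    -- -20 = 2·(-5)·(-6) - 4·(-4)·(-5); Fermat identifies the powers j^(2p-7) and j^(p-6).
    eval_derivative_two_of_sub_comp (shiftSum_two_mul_sub_comp hn (by omega)) (c := -20) n,
    eval_zero_derivative_two_shiftSum (2 * n) (by omega), nestedSum_two_mul hn hp5,
    invPowSum_five_zInv hn hp5]
  · ring
  · intro j hj
    have e1 : ((p - 4 : ℕ) : ZMod p) = -4 := by
      rw [Nat.cast_sub (by omega)]
      simp
    have e2 : ((p - 4 - 1 : ℕ) : ZMod p) = -5 := by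
      rw [Nat.sub_sub, Nat.cast_sub (by omega)]
      simp
    have e3 : ((2 * p - 5 : ℕ) : ZMod p) = -5 := by
      rw [Nat.cast_sub (by omega)]
      simp
    have e4 : ((2 * p - 5 - 1 : ℕ) : ZMod p) = -6 := by
      rw [Nat.sub_sub, Nat.cast_sub (by omega)]
      simp
    have h1 := ZMod.pow_card_sub_one_eq_one
      (natCast_ne_zero_of_lt (p := p) (j := j + 1) (by omega) (by omega))
    rw [zInv_pow_eq (by omega) (by omega) (by omega), show p - 1 - 5 = p - 4 - 1 - 1 by omega]
    have h3 : ((j + 1 : ℕ) : ZMod p) ^ (2 * p - 5 - 1 - 1) =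
        ((j + 1 : ℕ) : ZMod p) ^ (p - 4 - 1 - 1) := by
      rw [show 2 * p - 5 - 1 - 1 = (p - 4 - 1 - 1) + (p - 1) by omega, pow_add, h1, mul_one]
    push_cast at h3
    simp [e1, e2, e3, e4, h3, derivative_X_pow]
    ring

end

/-! ### The two congruences -/

section

variable {p : ℕ} [hp : Fact p.Prime] {n : ℕ}

theorem dvd_shiftSum_add (hn : p = 2 * n + 1) {N c : ℕ} (hN : n ≤ N) (hNp : N < p)
    (hc : Polynomial.eval ((n : ZMod p) * (n + 1))
      (Polynomial.derivative (shiftSum (polyInv p) Polynomial.X N)) =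
        c * pReduce p (pBernoulli p (p - 5))) :
    (p : pIntegers p) ^ 3 ∣ shiftSum (pInv p) (-pInv p 4) N + 2 * invPowSum (pInv p) 3 n +
      c * pInv p 4 * p ^ 2 * pBernoulli p (p - 5) := by
  have h2 : ¬ p ∣ 4 := by
    rw [show 4 = 2 * 2 by norm_num, hp.out.dvd_mul, or_self]
    intro h
    have := Nat.le_of_dvd (by norm_num) h
    have := hp.out.two_le
    omega
  have h4 : (4 : pIntegers p) * pInv p 4 = 1 := by exact_mod_cast natCast_mul_pInv h2
  set Q : Polynomial (pIntegers p) :=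
    shiftSum (fun j => Polynomial.C (pInv p j)) Polynomial.X N with hQ
  have hQe : ∀ l, Q.eval l = shiftSum (pInv p) l N := by
    intro l
    have := map_shiftSum (Polynomial.evalRingHom l) (fun j => Polynomial.C (pInv p j))
      Polynomial.X N
    simpa using this
  have hQm : Q.map (pReduce p) = shiftSum (polyInv p) Polynomial.X N := by
    have := map_shiftSum (Polynomial.mapRingHom (pReduce p)) (fun j => Polynomial.C (pInv p j))
      Polynomial.X N
    have e : polyInv p = fun j => Polynomial.C (pReduce p (pInv p j)) := rfl
    simpa [e] using this
  have hd : (p : pIntegers p) ∣ Q.derivative.eval ((n : pIntegers p) * (n + 1)) -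
      c * pBernoulli p (p - 5) := by
    apply dvd_of_pReduce_eq_zero
    have h := Polynomial.eval_map_apply (pReduce p) ((n : pIntegers p) * (n + 1))
      (p := Q.derivative)
    rw [← Polynomial.derivative_map, hQm] at h
    simp only [map_mul, map_add, map_natCast, map_one] at h
    rw [map_sub, ← h, hc]
    simp
  obtain ⟨d, hd⟩ := hd
  -- The increment -p^2/4 leads from n(n+1) to -1/4; its square is divisible by p^4.
  obtain ⟨k, hk⟩ := Q.binomExpansion ((n : pIntegers p) * (n + 1)) (-p ^ 2 * pInv p 4)
  have hpn : (p : pIntegers p) = 2 * n + 1 := by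
    rw [← Nat.cast_ofNat, ← Nat.cast_mul, ← Nat.cast_add_one, ← hn]
  have e : (n : pIntegers p) * (n + 1) + -p ^ 2 * pInv p 4 = -pInv p 4 := by
    rw [hpn]
    linear_combination (-(n : pIntegers p) * (n + 1)) * h4
  rw [e, hQe, hQe, shiftSum_natCast (ι := pInv p)
    (fun j h1 h2 => natCast_mul_pInv (not_prime_dvd_of_lt h1 (by omega))) n hN] at hk
  refine ⟨k * p * pInv p 4 ^ 2 - d * pInv p 4, ?_⟩
  linear_combination hk - p ^ 2 * pInv p 4 * hd

theorem coe_invPowSum {r N : ℕ} (hN : N < p) :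
    ((invPowSum (pInv p) r N : pIntegers p) : ℚ) = harmonicOrder r N := by
  rw [invPowSum, harmonicOrder, ← Ico_add_one_right_eq_Icc, sum_Ico_eq_sum_range]
  push_cast
  refine sum_congr (by simp) fun k hk => ?_
  have := mem_range.1 hk
  rw [coe_pInv (not_prime_dvd_of_lt (by omega) (by omega)), one_div, inv_pow, add_comm]
  push_cast
  rfl

theorem coe_shiftProd {k : ℕ} (hk : k < p) (hp2 : 2 < p) :
    ((shiftProd (pInv p) (-pInv p 4) k : pIntegers p) : ℚ) =
      ((2 * k).choose k : ℚ) ^ 2 / 16 ^ k := by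
  have h4 : ¬ p ∣ 4 := by
    rw [show 4 = 2 * 2 by norm_num, hp.out.dvd_mul, or_self]
    exact not_prime_dvd_of_lt (by omega) hp2
  induction k with
  | zero => simp [shiftProd]
  | succ k ih =>
    have h := congrArg (Nat.cast (R := ℚ)) (Nat.succ_mul_centralBinom_succ k)
    rw [shiftProd, prod_range_succ, ← shiftProd]
    push_cast at h ⊢
    rw [ih (by omega), coe_pInv h4, coe_pInv (not_prime_dvd_of_lt (by omega) hk)]
    rw [Nat.centralBinom_eq_two_mul_choose, Nat.centralBinom_eq_two_mul_choose] at h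
    have hk0 : (k : ℚ) + 1 ≠ 0 := by positivity
    have e : (((2 * (k + 1)).choose (k + 1) : ℕ) : ℚ) =
        2 * (2 * k + 1) * ((2 * k).choose k : ℚ) / (k + 1) := by
      rw [eq_div_iff hk0, ← h]
      ring
    rw [e]
    push_cast
    field_simp
    ring

theorem coe_shiftSum {N : ℕ} (hN : N < p) (hp2 : 2 < p) :
    ((shiftSum (pInv p) (-pInv p 4) N : pIntegers p) : ℚ) =
      ∑ k ∈ Icc 1 N, harmonicOrder 2 k / ((k : ℚ) * 16 ^ k) * ((2 * k).choose k : ℚ) ^ 2 := by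
  rw [shiftSum, ← Ico_add_one_right_eq_Icc, sum_Ico_eq_sum_range]
  push_cast
  refine sum_congr (by simp) fun k hk => ?_
  have := mem_range.1 hk
  rw [coe_invPowSum (by omega), coe_shiftProd (by omega) hp2,
    coe_pInv (not_prime_dvd_of_lt (by omega) (by omega)), add_comm 1 k]
  push_cast
  field_simp
  ring

theorem ratCongr_first (hn : p = 2 * n + 1) (hp5 : 5 < p) :
    RatCongr p 3
      (∑ k ∈ Icc 1 (p - 1),
        harmonicOrder 2 k / ((k : ℚ) * 16 ^ k) * ((2 * k).choose k : ℚ) ^ 2)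
      (-12 * (harmonic (p - 1) / (p : ℚ) ^ 2) + 7 / 10 * (p : ℚ) ^ 2 * bernoulli (p - 5)) := by
  have h2 : ¬ p ∣ 2 := not_prime_dvd_of_lt (by omega) (by omega)
  have h3 : ¬ p ∣ 3 := not_prime_dvd_of_lt (by omega) (by omega)
  have h5 : ¬ p ∣ 5 := not_prime_dvd_of_lt (by omega) (by omega)
  have d4 : ¬ p ∣ 4 := by rw [show 4 = 2 * 2 by norm_num]; simp only [hp.out.dvd_mul, h2, or_self, not_false_eq_true]
  have d10 : ¬ p ∣ 10 := by rw [show 10 = 2 * 5 by norm_num]; simp only [hp.out.dvd_mul, h2, h5, or_self, not_false_eq_true]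
  have d20 : ¬ p ∣ 20 := by rw [show 20 = 2 * 2 * 5 by norm_num]; simp only [hp.out.dvd_mul, h2, h5, or_self, not_false_eq_true]
  have d24 : ¬ p ∣ 24 := by
    rw [show 24 = 2 * 2 * 2 * 3 by norm_num]; simp only [hp.out.dvd_mul, h2, h3, or_self, not_false_eq_true]
  have e4 : (4 : pIntegers p) * pInv p 4 = 1 := by exact_mod_cast natCast_mul_pInv d4
  have e10 : (10 : pIntegers p) * pInv p 10 = 1 := by exact_mod_cast natCast_mul_pInv d10
  have e20 : (20 : pIntegers p) * pInv p 20 = 1 := by exact_mod_cast natCast_mul_pInv d20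
  have e24 : (24 : pIntegers p) * pInv p 24 = 1 := by exact_mod_cast natCast_mul_pInv d24
  obtain ⟨a, ha⟩ := dvd_shiftSum_add hn (N := 2 * n) (c := 62) (by omega) (by omega)
    (by exact_mod_cast eval_derivative_shiftSum_two_mul hn hp5)
  obtain ⟨b, hb⟩ := dvd_harmonic_sub_of_two_mul_add_one hn
  obtain ⟨c, hc⟩ := dvd_invPowSum_four (by omega) hn
  obtain ⟨d, hd⟩ : (p : pIntegers p) ∣
      invPowSum (pInv p) 5 n + 6 * pBernoulli p (p - 5) := by
    apply dvd_of_pReduce_eq_zero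
    have := invPowSum_five_zInv hn hp5
    rw [map_add, map_mul, map_invPowSum, map_ofNat]
    change invPowSum (zInv p) 5 n + _ = 0
    rw [this]
    ring
  obtain ⟨W, hW⟩ : ∃ W, W = pInv p 24 * (4 * invPowSum (pInv p) 3 n +
    6 * p * invPowSum (pInv p) 4 n + 7 * p ^ 2 * invPowSum (pInv p) 5 n + p ^ 3 * b) := ⟨_, rfl⟩
  have hH : invPowSum (pInv p) 1 (2 * n) = p ^ 2 * W := by
    rw [hW]
    linear_combination pInv p 24 * hb - invPowSum (pInv p) 1 (2 * n) * e24
  have hW' : (W : ℚ) = harmonic (p - 1) / (p : ℚ) ^ 2 := by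
    have hp0 : (p : ℚ) ^ 2 ≠ 0 := pow_ne_zero _ (by exact_mod_cast hp.out.ne_zero)
    rw [eq_div_iff hp0, ← harmonicOrder_one, show p - 1 = 2 * n by omega,
      ← coe_invPowSum (p := p) (by omega), hH]
    push_cast
    ring
  have key : (p : pIntegers p) ^ 3 ∣ shiftSum (pInv p) (-pInv p 4) (2 * n) -
      (-12 * W + 7 * pInv p 10 * p ^ 2 * pBernoulli p (p - 5)) := by
    -- Modulo p^3, -2 H_n^{(3)} ≡ -12 W - (27/10) p^2 H_n^{(5)} ≡ -12 W + (81/5) p^2 B_{p-5}, and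
    -- 81/5 - 31/2 = 7/10. The factor 20 clears denominators.
    refine ⟨pInv p 20 * (20 * a + 10 * b + 4 * c - 54 * d), ?_⟩
    push_cast at ha
    linear_combination pInv p 20 * (20 * ha + 240 * hW + 4 * p * hc - 54 * p ^ 2 * hd -
      310 * p ^ 2 * pBernoulli p (p - 5) * e4 - 14 * p ^ 2 * pBernoulli p (p - 5) * e10 +
      10 * (4 * invPowSum (pInv p) 3 n +
    6 * p * invPowSum (pInv p) 4 n + 7 * p ^ 2 * invPowSum (pInv p) 5 n + p ^ 3 * b) * e24) -
      (shiftSum (pInv p) (-pInv p 4) (2 * n) -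
      (-12 * W + 7 * pInv p 10 * p ^ 2 * pBernoulli p (p - 5))) * e20
  have := ratCongr_of_dvd_sub _ _ key
  push_cast at this
  rw [coe_shiftSum (by omega) (by omega), hW', coe_pBernoulli (by omega), coe_pInv d10,
    show 2 * n = p - 1 by omega, show ((12 : pIntegers p) : ℚ) = 12 from rfl,
    show ((7 : pIntegers p) : ℚ) = 7 from rfl] at this
  convert this using 2
  push_cast
  ring

theorem ratCongr_second (hn : p = 2 * n + 1) (hp5 : 5 < p) :
    RatCongr p 3
      (∑ k ∈ Icc ((p + 1) / 2) (p - 1),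
        harmonicOrder 2 k / ((k : ℚ) * 16 ^ k) * ((2 * k).choose k : ℚ) ^ 2)
      (31 / 2 * (p : ℚ) ^ 2 * bernoulli (p - 5)) := by
  have h2 : ¬ p ∣ 2 := not_prime_dvd_of_lt (by omega) (by omega)
  have d4 : ¬ p ∣ 4 := by rw [show 4 = 2 * 2 by norm_num]; simp only [hp.out.dvd_mul, h2, or_self, not_false_eq_true]
  have e2 : (2 : pIntegers p) * pInv p 2 = 1 := by exact_mod_cast natCast_mul_pInv h2
  have e4 : (4 : pIntegers p) * pInv p 4 = 1 := by exact_mod_cast natCast_mul_pInv d4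
  obtain ⟨a, ha⟩ := dvd_shiftSum_add hn (N := 2 * n) (c := 62) (by omega) (by omega)
    (by exact_mod_cast eval_derivative_shiftSum_two_mul hn hp5)
  obtain ⟨b, hb⟩ := dvd_shiftSum_add hn (N := n) (c := 124) le_rfl (by omega)
    (by exact_mod_cast eval_derivative_shiftSum_half hn hp5)
  have key : (p : pIntegers p) ^ 3 ∣ shiftSum (pInv p) (-pInv p 4) (2 * n) -
      shiftSum (pInv p) (-pInv p 4) n - 31 * pInv p 2 * p ^ 2 * pBernoulli p (p - 5) := by
    refine ⟨a - b, ?_⟩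
    push_cast at ha hb
    linear_combination ha - hb + 31 * p ^ 2 * pBernoulli p (p - 5) *
      (pInv p 2 * e4 - 2 * pInv p 4 * e2)
  have := ratCongr_of_dvd_sub _ _ key
  push_cast at this
  rw [coe_shiftSum (by omega) (by omega), coe_shiftSum (by omega) (by omega),
    coe_pBernoulli (by omega), coe_pInv h2,
    show ((31 : pIntegers p) : ℚ) = 31 from rfl] at this
  have e : Icc 1 (2 * n) = Icc 1 n ∪ Icc ((p + 1) / 2) (p - 1) := by
    ext x
    simp only [mem_union, mem_Icc]
    omega
  have hdisj : Disjoint (Icc 1 n) (Icc ((p + 1) / 2) (p - 1)) := by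
    rw [disjoint_left]
    intro x
    simp only [mem_Icc]
    omega
  rw [e, sum_union hdisj, add_sub_cancel_left] at this
  convert this using 2
  push_cast
  ring

end

theorem mainTheorem1 (p : ℕ) (hp : p.Prime) (hp3 : 3 < p) :
    RatCongr p 3
      (∑ k ∈ Finset.Icc 1 (p - 1),
        harmonicOrder 2 k / ((k : ℚ) * 16 ^ k) * ((2 * k).choose k : ℚ) ^ 2)
      (-12 * (harmonic (p - 1) / (p : ℚ) ^ 2) + 7 / 10 * (p : ℚ) ^ 2 * bernoulli (p - 5)) ∧
    RatCongr p 3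
      (∑ k ∈ Finset.Icc ((p + 1) / 2) (p - 1),
        harmonicOrder 2 k / ((k : ℚ) * 16 ^ k) * ((2 * k).choose k : ℚ) ^ 2)
      (31 / 2 * (p : ℚ) ^ 2 * bernoulli (p - 5)) := by
  have := Fact.mk hp
  -- For p = 5 the general argument fails (it divides by 5 and uses H_{p-1}^{(5)} ≡ 0), so that case
  -- is computed.
  rcases (show 5 ≤ p by
    by_contra h
    obtain rfl : p = 4 := by omega
    norm_num at hp).eq_or_lt with rfl | h5
  · simp only [RatCongr, harmonicOrder, harmonic_eq_sum_Icc, bernoulli_zero,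
      Nat.reduceSub, Nat.reduceAdd, Nat.reduceDiv]
    constructor <;> decide +kernel
  · obtain ⟨n, hn⟩ := hp.odd_of_ne_two (by omega)
    exact ⟨ratCongr_first hn h5, ratCongr_second hn h5⟩
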